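/- Let $\mathcal X,\mathcal Y$ be finite alphabets. A general correlated source $(\mathbf X,\mathbf Y)=\{(X^n,Y^n)\}_{n\ge 1}$ is a sequence of random pairs $(X^n,Y^n)$ with arbitrary joint distributions $P_{X^nY^n}$ on $\mathcal X^n\times\mathcal Y^n$. Let $d$ denote the Hamming distance. The source is smooth with respect to $\mathbf Y$ if there is a constant $0<q<1$, independent of $n$, such that $P_{X^nY^n}(\mathbf x,\hat{\mathbf y})\ge q\,P_{X^nY^n}(\mathbf x,\mathbf y)$ for all $n\ge1$, all $\mathbf x\in\mathcal X^n$ and all $\mathbf y,\hat{\mathbf y}\in\mathcal Y^n$ with $d(\mathbf y,\hat{\mathbf y})=1$; smoothness with respect to $\mathbf X$ is defined by exchanging the roles, and the source is smooth if it is smooth with respect to both $\mathbf X$ and $\mathbf Y$. A function $f_n:\mathcal X^n\times\mathcal Y^n\to\mathcal Z_n$ is sensitive conditioned on $\mathcal Y^n$ if, whenever $f_n(\mathbf x,\mathbf y)=f_n(\hat{\mathbf x},\mathbf y)$ and $x_i\ne\hat x_i$, there is $\hat{\mathbf y}\in\mathcal Y^n$ with $\hat y_i\neq y_i$, $\hat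 y_j=y_j$ for all $j\ne i$, and $f_n(\mathbf x,\hat{\mathbf y})\neq f_n(\hat{\mathbf x},\hat{\mathbf y})$; sensitivity conditioned on $\mathcal X^n$ is defined by exchanging the roles. It is jointly sensitive if $f_n(\mathbf x,\mathbf y)\ne f_n(\hat{\mathbf x},\hat{\mathbf y})$ whenever $\mathbf x\neq\hat{\mathbf x}$ and $\mathbf y\ne\hat{\mathbf y}$. It is totally sensitive if it is jointly sensitive and sensitive conditioned on both $\mathcal X^n$ and $\mathcal Y^n$. A sequence $\mathbf f=\{f_n\}_{n\ge1}$ is totally sensitive if every $f_n$ is. A (variable-length) code $\Phi_n$ with values in $\mathcal Z_n$ consists of encoders $\varphi_n^{(1)}:\mathcal X^n\to\{0,1\}^*$ and $\varphi_n^{(2)}:\mathcal Y^n\to\{0,1\}^*$, whose sets of codewords $\mathcal C_n^{(1)},\mathcal C_n^{(2)}$ (their images) both satisfy the prefix condition, and a decoder $\psi_n:\mathcal C_n^{(1)}\times\mathcal C_n^{(2)}\to\mathcal Z_n$. It is a fixed-length code if, for each $i=1,2$, all codewords in $\mathcal C_n^{(i)}$ have the same length. A pair $(R_1,R_2)$ of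 real numbers is achievable for computing $\mathbf f$ by variable-length (resp. fixed-length) coding if there are variable-length (resp. fixed-length) codes $\Phi_n$, $n\ge1$, with $\Pr\{f_n(X^n,Y^n)\ne\psi_n(\varphi_n^{(1)}(X^n),\varphi_n^{(2)}(Y^n))\}\to0$, $\limsup_{n\to\infty}\frac1n\mathbb E|\varphi_n^{(1)}(X^n)|\le R_1$ and $\limsup_{n\to\infty}\frac1n\mathbb E|\varphi_n^{(2)}(Y^n)|\le R_2$, where $|\cdot|$ is the length of a string. Let $\mathcal R^{\mathrm{vl}}(\mathbf X,\mathbf Y|\mathbf f)$ (resp. $\mathcal R^{\mathrm{fl}}(\mathbf X,\mathbf Y|\mathbf f)$) be the set of all such pairs. The Slepian–Wolf regions $\mathcal R^{\mathrm{vl}}_{\mathrm{SW}}(\mathbf X,\mathbf Y)$ and $\mathcal R^{\mathrm{fl}}_{\mathrm{SW}}(\mathbf X,\mathbf Y)$ are these sets for the identity functions $f_n(\mathbf x,\mathbf y)=(\mathbf x,\mathbf y)$. **Theorem.** Suppose that the general correlated source $(\mathbf X,\mathbf Y)$ is smooth and that $\mathbf f$ is totally sensitive. Then $$\mathcal R^{\mathrm{fl}}(\mathbf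 X,\mathbf Y|\mathbf f)=\mathcal R^{\mathrm{fl}}_{\mathrm{SW}}(\mathbf X,\mathbf Y)\quad\text{and}\quad \mathcal R^{\mathrm{vl}}(\mathbf X,\mathbf Y|\mathbf f)=\mathcal R^{\mathrm{vl}}_{\mathrm{SW}}(\mathbf X,\mathbf Y).$$ -/

import Mathlib

namespace FunctionComputation

noncomputable section

/-- A general correlated source with alphabets `X` and `Y`: for every block length `n`, an arbitrary
joint distribution of `(X^n, Y^n)` on `X^n × Y^n` (no consistency between different `n`).
Only block lengths `n ≥ 1` matter below. -/
abbrev GeneralSource (X Y : Type*) :=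
  ∀ n : ℕ, PMF ((Fin n → X) × (Fin n → Y))

/-- The source is smooth with respect to its second component. -/
def SmoothSnd {X Y : Type*} [DecidableEq Y] (P : GeneralSource X Y) : Prop :=
  ∃ q : ℝ, 0 < q ∧ q < 1 ∧ ∀ n : ℕ, 1 ≤ n → ∀ (x : Fin n → X) (y y' : Fin n → Y),
    hammingDist y y' = 1 → q * (P n (x, y)).toReal ≤ (P n (x, y')).toReal

/-- The source is smooth with respect to its first component. -/
def SmoothFst {X Y : Type*} [DecidableEq X] (P : GeneralSource X Y) : Prop :=
  ∃ q : ℝ, 0 < q ∧ q < 1 ∧ ∀ n : ℕ, 1 ≤ n → ∀ (x x' : Fin n → X) (y : Fin n → Y),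
    hammingDist x x' = 1 → q * (P n (x, y)).toReal ≤ (P n (x', y)).toReal

/-- A smooth source: smooth with respect to both components. -/
def Smooth {X Y : Type*} [DecidableEq X] [DecidableEq Y] (P : GeneralSource X Y) : Prop :=
  SmoothFst P ∧ SmoothSnd P

/-- `f` is sensitive conditioned on `Y^n`. -/
def SensitiveCondSnd {X Y Z : Type*} {n : ℕ} (f : (Fin n → X) → (Fin n → Y) → Z) : Prop :=
  ∀ (x x' : Fin n → X) (y : Fin n → Y) (i : Fin n), f x y = f x' y → x i ≠ x' i →
    ∃ y' : Fin n → Y, y' i ≠ y i ∧ (∀ j, j ≠ i → y' j = y j) ∧ f x y' ≠ f x' y'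

/-- `f` is sensitive conditioned on `X^n`. -/
def SensitiveCondFst {X Y Z : Type*} {n : ℕ} (f : (Fin n → X) → (Fin n → Y) → Z) : Prop :=
  ∀ (x : Fin n → X) (y y' : Fin n → Y) (i : Fin n), f x y = f x y' → y i ≠ y' i →
    ∃ x' : Fin n → X, x' i ≠ x i ∧ (∀ j, j ≠ i → x' j = x j) ∧ f x' y ≠ f x' y'

/-- Joint sensitivity. -/
def JointlySensitive {X Y Z : Type*} {n : ℕ} (f : (Fin n → X) → (Fin n → Y) → Z) : Prop :=
  ∀ (x x' : Fin n → X) (y y' : Fin n → Y), x ≠ x' → y ≠ y' → f x y ≠ f x' y'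

/-- Total sensitivity of a single function. -/
def TotallySensitive {X Y Z : Type*} {n : ℕ} (f : (Fin n → X) → (Fin n → Y) → Z) : Prop :=
  JointlySensitive f ∧ SensitiveCondFst f ∧ SensitiveCondSnd f

/-- A variable-length code with two encoders (inputs in `A` and `B`) and a decoder with values in
`Z`: the sets of codewords of both encoders satisfy the prefix condition, and the decoder is defined
on pairs of codewords. -/
structure Code (A B Z : Type*) where
  enc₁ : A → List Bool
  enc₂ : B → List Bool
  dec : Set.range enc₁ × Set.range enc₂ → Z
  prefix₁ : ∀ c ∈ Set.range enc₁, ∀ c' ∈ Set.range enc₁, c <+: c' → c = c'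
  prefix₂ : ∀ c ∈ Set.range enc₂, ∀ c' ∈ Set.range enc₂, c <+: c' → c = c'

/-- A fixed-length code: for each encoder, all codewords have the same length. -/
def Code.IsFixedLength {A B Z : Type*} (Φ : Code A B Z) : Prop :=
  (∀ a a' : A, (Φ.enc₁ a).length = (Φ.enc₁ a').length) ∧
  (∀ b b' : B, (Φ.enc₂ b).length = (Φ.enc₂ b').length)

/-- The output of the decoder when the encoders observe `a` and `b`. -/
def Code.output {A B Z : Type*} (Φ : Code A B Z) (a : A) (b : B) : Z :=
  Φ.dec (⟨Φ.enc₁ a, a, rfl⟩, ⟨Φ.enc₂ b, b, rfl⟩)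

/-- Average codeword length of an encoder `φ` when its input has distribution `p`. -/
def avgLength {A : Type*} [Fintype A] (p : PMF A) (φ : A → List Bool) : ℝ :=
  ∑ a, (p a).toReal * ((φ a).length : ℝ)

open Classical in
/-- The probability that the decoder's output differs from the value of `f`. -/
def Code.errorProb {A B Z : Type*} [Fintype A] [Fintype B] (Φ : Code A B Z)
    (p : PMF (A × B)) (f : A → B → Z) : ℝ :=
  ∑ ab : A × B with f ab.1 ab.2 ≠ Φ.output ab.1 ab.2, (p ab).toReal

/-- The sequence of codes `Φ` computes `f` with vanishing error probability and asymptotic average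
rates at most `R.1` and `R.2`. The upper limits are taken in the extended reals. -/
def Attains {X Y : Type*} [Fintype X] [Fintype Y] {Z : ℕ → Type*} (P : GeneralSource X Y)
    (f : ∀ n, (Fin n → X) → (Fin n → Y) → Z n)
    (Φ : ∀ n, Code (Fin n → X) (Fin n → Y) (Z n)) (R : ℝ × ℝ) : Prop :=
  Filter.Tendsto (fun n => (Φ n).errorProb (P n) (f n)) Filter.atTop (nhds 0) ∧
  Filter.limsup (fun n : ℕ =>
      ((avgLength ((P n).map Prod.fst) (Φ n).enc₁ / (n : ℝ) : ℝ) : EReal)) Filter.atTop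
    ≤ ((R.1 : ℝ) : EReal) ∧
  Filter.limsup (fun n : ℕ =>
      ((avgLength ((P n).map Prod.snd) (Φ n).enc₂ / (n : ℝ) : ℝ) : EReal)) Filter.atTop
    ≤ ((R.2 : ℝ) : EReal)

/-- The set of rate pairs achievable by variable-length (prefix) coding for computing `f`. -/
def regionVL {X Y : Type*} [Fintype X] [Fintype Y] {Z : ℕ → Type*} (P : GeneralSource X Y)
    (f : ∀ n, (Fin n → X) → (Fin n → Y) → Z n) : Set (ℝ × ℝ) :=
  {R | ∃ Φ : ∀ n, Code (Fin n → X) (Fin n → Y) (Z n), Attains P f Φ R}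

/-- The set of rate pairs achievable by fixed-length coding for computing `f`. -/
def regionFL {X Y : Type*} [Fintype X] [Fintype Y] {Z : ℕ → Type*} (P : GeneralSource X Y)
    (f : ∀ n, (Fin n → X) → (Fin n → Y) → Z n) : Set (ℝ × ℝ) :=
  {R | ∃ Φ : ∀ n, Code (Fin n → X) (Fin n → Y) (Z n),
    (∀ n, (Φ n).IsFixedLength) ∧ Attains P f Φ R}

/-- The sequence of identity functions `(x, y) ↦ (x, y)`. -/
def idFun (X Y : Type*) (n : ℕ) (x : Fin n → X) (y : Fin n → Y) :
    (Fin n → X) × (Fin n → Y) := (x, y)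

/-- The Slepian-Wolf region for variable-length coding. -/
def regionSWVL {X Y : Type*} [Fintype X] [Fintype Y] (P : GeneralSource X Y) : Set (ℝ × ℝ) :=
  regionVL P (idFun X Y)

/-- The Slepian-Wolf region for fixed-length coding. -/
def regionSWFL {X Y : Type*} [Fintype X] [Fintype Y] (P : GeneralSource X Y) : Set (ℝ × ℝ) :=
  regionFL P (idFun X Y)

end

end FunctionComputation

/-! A code for the identity yields one for `f` by post-processing, so the content is the converse: a
code for `f` with error probability ε recovers both inputs once o(n) bits are appended to each
codeword.

Call a coordinate of `y` exposed, for fixed `x`, if changing it can lead to a pair decoded wrongly.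
Smoothness charges each exposed coordinate to an erroneous pair, so by Markov the pairs with more
than δn exposed coordinates have mass O(ε/δ) (`sum_exposedCoords_gt_le`). Discard these, the
analogous pairs for `x`, and the erroneous pairs.

Let two remaining pairs share both codewords; then `f` agrees on them, and joint sensitivity leaves
at most one component different. If `y` is common and `x`, `x'` differ at `i`, conditional
sensitivity changes `y` at `i` so that the values of `f` differ while the decoder's outputs
coincide. One of the two new pairs is erroneous, so `i` is exposed. Hence `x` and `x'` are at
distance at most 2δn (`hammingDist_le_of_exposed`), and a colouring separating such words identifies
the pair (`exists_identity_code`). The colouring costs o(n) bits if δ → 0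
(`exists_sublinear_log_card_hammingBall`); δ is chosen so that ε/δ → 0 too. -/

namespace FunctionComputation

open Filter Topology

/-! ### Volume and colouring of Hamming balls -/

section HammingBalls

variable {A : Type*} [Fintype A] [DecidableEq A] {n : ℕ}

/-- Generating-function bound for the volume of a Hamming ball. -/
lemma card_hammingBall_mul_pow_le (x : Fin n → A) (k : ℕ) {t : ℝ} (ht : 0 < t) (ht1 : t ≤ 1) :
    ((Finset.univ.filter fun x' => hammingDist x x' ≤ k).card : ℝ) * t ^ k
      ≤ (1 + t * Fintype.card A) ^ n := by
  -- The weight factorises over coordinates, so its sum over all words is a product.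
  have h1 : ∀ x' : Fin n → A,
      t ^ hammingDist x x' = ∏ i, (if x i ≠ x' i then t else 1) := by
    intro x'
    rw [Finset.prod_ite]
    simp [hammingDist]
  calc ((Finset.univ.filter fun x' => hammingDist x x' ≤ k).card : ℝ) * t ^ k
      = ∑ x' with hammingDist x x' ≤ k, t ^ k := by simp
    _ ≤ ∑ x' with hammingDist x x' ≤ k, t ^ hammingDist x x' := by
        refine Finset.sum_le_sum fun x' hx' => ?_
        exact pow_le_pow_of_le_one ht.le ht1 (Finset.mem_filter.1 hx').2
    _ ≤ ∑ x', t ^ hammingDist x x' :=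
        Finset.sum_le_sum_of_subset_of_nonneg (Finset.filter_subset _ _)
          fun _ _ _ => by positivity
    _ = ∏ i : Fin n, ∑ b : A, (if x i ≠ b then t else 1) := by
        simp_rw [h1]
        rw [Finset.prod_univ_sum]
        simp
    _ ≤ ∏ _i : Fin n, (1 + t * Fintype.card A) := by
        refine Finset.prod_le_prod
          (fun i _ => Finset.sum_nonneg fun b _ => by split_ifs <;> positivity) fun i _ => ?_
        calc ∑ b : A, (if x i ≠ b then t else 1)
            ≤ ∑ b : A, ((if x i = b then 1 else 0) + t) := by
              refine Finset.sum_le_sum fun b _ => ?_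
              by_cases h : x i = b <;> simp [h, ht.le]
          _ = 1 + t * Fintype.card A := by
              simp [Finset.sum_add_distrib, mul_comm]
    _ = (1 + t * Fintype.card A) ^ n := by simp

/-- Greedy colouring: if every Hamming ball of radius `k` has at most as many points as there are
colours, then distinct points at distance at most `k` can be given distinct colours. -/
lemma exists_hamming_coloring {C : Type*} [Fintype C] (k : ℕ)
    (hC : ∀ x : Fin n → A,
      (Finset.univ.filter fun x' => hammingDist x x' ≤ k).card ≤ Fintype.card C) :
    ∃ c : (Fin n → A) → C, ∀ x x', x ≠ x' → hammingDist x x' ≤ k → c x ≠ c x' := by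
  classical
  suffices H : ∀ S : Finset (Fin n → A), ∃ c : (Fin n → A) → C,
      ∀ x ∈ S, ∀ x' ∈ S, x ≠ x' → hammingDist x x' ≤ k → c x ≠ c x' by
    obtain ⟨c, hc⟩ := H Finset.univ
    exact ⟨c, fun x x' => hc x (Finset.mem_univ _) x' (Finset.mem_univ _)⟩
  intro S
  induction S using Finset.induction_on with
  | empty =>
    have hne : ∀ _ : Fin n → A, Nonempty C := fun x => by
      refine Fintype.card_pos_iff.1 (lt_of_lt_of_le (Finset.card_pos.2 ⟨x, ?_⟩) (hC x))
      simp
    exact ⟨fun x => (hne x).some, by simp⟩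
  | insert a S ha ih =>
    obtain ⟨c, hc⟩ := ih
    -- Colours to avoid at `a`. Erasing the centre from its ball guarantees a spare colour.
    set T := ((Finset.univ.filter fun x' => hammingDist a x' ≤ k).erase a).image c with hT
    have hlt : T.card < Fintype.card C := by
      refine lt_of_le_of_lt Finset.card_image_le (lt_of_lt_of_le ?_ (hC a))
      exact Finset.card_erase_lt_of_mem (by simp)
    obtain ⟨e, he⟩ : ∃ e, e ∉ T := by
      by_contra! h
      exact hlt.ne (by rw [Finset.eq_univ_iff_forall.2 h, Finset.card_univ])
    have hfar : ∀ x, x ≠ a → hammingDist a x ≤ k → c x ≠ e := by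
      rintro x hxa hd rfl
      exact he (Finset.mem_image_of_mem c (by simp [hxa, hd]))
    refine ⟨Function.update c a e, ?_⟩
    intro x hx x' hx' hne hd
    rcases Finset.mem_insert.1 hx with rfl | hx <;> rcases Finset.mem_insert.1 hx' with rfl | hx'
    · exact absurd rfl hne
    · rw [Function.update_self, Function.update_of_ne hne.symm]
      exact (hfar x' hne.symm hd).symm
    · rw [Function.update_self, Function.update_of_ne hne]
      exact hfar x hne (by rwa [hammingDist_comm])
    · have h1 : x ≠ a := fun h => ha (h ▸ hx)
      have h2 : x' ≠ a := fun h => ha (h ▸ hx')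
      rw [Function.update_of_ne h1, Function.update_of_ne h2]
      exact hc x hx x' hx' hne hd

variable (A) in
/-- Hamming balls of sublinear radius have subexponential volume. -/
lemma exists_sublinear_log_card_hammingBall {δ : ℕ → ℝ} (hδ : ∀ n, 0 < δ n)
    (hδ0 : Tendsto δ atTop (𝓝 0)) :
    ∃ l : ℕ → ℕ, Tendsto (fun n => (l n : ℝ) / n) atTop (𝓝 0) ∧
      ∀ n (x : Fin n → A),
        (Finset.univ.filter fun x' => hammingDist x x' ≤ 2 * ⌊δ n * n⌋₊).card ≤ 2 ^ l n := by
  set m : ℝ := (Fintype.card A : ℝ) with hm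
  have hm0 : 0 ≤ m := by positivity
  -- The generating-function bound needs `t ≤ 1`; eventually `t n = δ n`.
  set t : ℕ → ℝ := fun n => min (δ n) 1 with ht
  have ht0 : ∀ n, 0 < t n := fun n => lt_min (hδ n) one_pos
  have ht1 : ∀ n, t n ≤ 1 := fun n => min_le_right _ _
  -- With radius at most 2δn, the bound on the volume is at most 2 to the power `n * h n`.
  set h : ℕ → ℝ := fun n => 2 * δ n * (-Real.logb 2 (t n)) + Real.logb 2 (1 + t n * m) with hh
  have hlog : ∀ n, 0 ≤ -Real.logb 2 (t n) := fun n =>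
    neg_nonneg.2 (Real.logb_nonpos one_lt_two (ht0 n).le (ht1 n))
  have hpos : ∀ n, 0 ≤ h n := fun n => by
    have h1 : 0 ≤ Real.logb 2 (1 + t n * m) :=
      Real.logb_nonneg one_lt_two (by nlinarith [mul_nonneg (ht0 n).le hm0])
    have h2 := mul_nonneg (mul_nonneg two_pos.le (hδ n).le) (hlog n)
    exact add_nonneg h2 h1
  have hlim : Tendsto h atTop (𝓝 0) := by
    have ht_lim : Tendsto t atTop (𝓝 0) := by
      simpa using hδ0.min (tendsto_const_nhds (x := (1 : ℝ)))
    have e1 : Tendsto (fun n => 2 * δ n * (-Real.logb 2 (t n))) atTop (𝓝 0) := by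
      have h1 : Tendsto (fun n => -2 / Real.log 2 * (δ n * Real.log (δ n))) atTop (𝓝 0) := by
        have := (Real.continuous_mul_log.tendsto 0).comp hδ0
        simpa using this.const_mul (-2 / Real.log 2)
      refine h1.congr' ?_
      filter_upwards [hδ0.eventually (gt_mem_nhds one_pos)] with n hn
      simp only [ht, min_eq_left hn.le, Real.logb]
      ring
    have e2 : Tendsto (fun n => Real.logb 2 (1 + t n * m)) atTop (𝓝 0) := by
      have h1 : Tendsto (fun n => 1 + t n * m) atTop (𝓝 1) := by
        simpa using (ht_lim.mul_const m).const_add 1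
      have h2 := ((Real.continuousAt_log one_ne_zero).tendsto.comp h1).div_const (Real.log 2)
      simpa [Real.logb, Function.comp_def] using h2
    simpa only [add_zero] using e1.add e2
  refine ⟨fun n => ⌈n * h n⌉₊, ?_, fun n x => ?_⟩
  · have hup : Tendsto (fun n : ℕ => h n + 1 / (n : ℝ)) atTop (𝓝 0) := by
      simpa using hlim.add tendsto_one_div_atTop_nhds_zero_nat
    refine squeeze_zero' (Eventually.of_forall fun n => by positivity) ?_ hup
    filter_upwards [eventually_gt_atTop 0] with n hn
    have hn' : (0 : ℝ) < n := by exact_mod_cast hn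
    rw [div_le_iff₀ hn', add_mul, one_div, inv_mul_cancel₀ hn'.ne', mul_comm (h n)]
    exact (Nat.ceil_lt_add_one (mul_nonneg hn'.le (hpos n))).le
  · set k := ⌊δ n * n⌋₊ with hk
    have hkle : (k : ℝ) ≤ δ n * n := Nat.floor_le (mul_nonneg (hδ n).le n.cast_nonneg)
    have hb := card_hammingBall_mul_pow_le x (2 * k) (ht0 n) (ht1 n)
    have hbase : 0 < 1 + t n * m := by nlinarith [mul_nonneg (ht0 n).le hm0]
    have e1 : t n ^ (2 * k) = (2 : ℝ) ^ (Real.logb 2 (t n) * (2 * k : ℝ)) := by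
      rw [Real.rpow_mul two_pos.le, Real.rpow_logb two_pos (by norm_num) (ht0 n)]
      exact_mod_cast (Real.rpow_natCast (t n) (2 * k)).symm
    have e2 : (1 + t n * m) ^ n = (2 : ℝ) ^ (Real.logb 2 (1 + t n * m) * n) := by
      rw [Real.rpow_mul two_pos.le, Real.rpow_logb two_pos (by norm_num) hbase, Real.rpow_natCast]
    rw [← hm, e1, e2, ← le_div_iff₀ (by positivity), ← Real.rpow_sub two_pos] at hb
    have hle : Real.logb 2 (1 + t n * m) * n - Real.logb 2 (t n) * (2 * k : ℝ)
        ≤ (⌈n * h n⌉₊ : ℝ) := by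
      refine le_trans ?_ (Nat.le_ceil _)
      have := mul_le_mul_of_nonneg_right hkle (hlog n)
      simp only [hh]
      nlinarith
    have := hb.trans (Real.rpow_le_rpow_of_exponent_le one_le_two hle)
    rw [Real.rpow_natCast] at this
    exact_mod_cast this

end HammingBalls

/-! ### Exposed coordinates and smoothness -/

section Smoothness

variable {A B : Type*} {n : ℕ}

/-- The coordinates at which `y` can be changed to a point of `E`. -/
noncomputable def exposedCoords (E : Set (Fin n → B)) (y : Fin n → B) : Finset (Fin n) :=
  open Classical in Finset.univ.filter fun i => ∃ b, Function.update y i b ∈ E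

/-- If every coordinate where `u` and `v` differ is exposed at `z` to one of two sets, then the
distance of `u` and `v` is controlled by the numbers of exposed coordinates. -/
lemma hammingDist_le_of_exposed {E E' : Set (Fin n → B)} {D : Type*} [DecidableEq D]
    {z : Fin n → B} {u v : Fin n → D} {k : ℕ}
    (hE : (exposedCoords E z).card ≤ k) (hE' : (exposedCoords E' z).card ≤ k)
    (h : ∀ i, u i ≠ v i → ∃ b, Function.update z i b ∈ E ∨ Function.update z i b ∈ E') :
    hammingDist u v ≤ 2 * k := by
  classical
  have hsub : (Finset.univ.filter fun i => u i ≠ v i)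
      ⊆ exposedCoords E z ∪ exposedCoords E' z := by
    intro i hi
    obtain ⟨b, hb⟩ := h i (Finset.mem_filter.1 hi).2
    simp only [exposedCoords, Finset.mem_union, Finset.mem_filter, Finset.mem_univ, true_and]
    exact hb.imp (fun h => ⟨b, h⟩) fun h => ⟨b, h⟩
  have := (Finset.card_le_card hsub).trans (Finset.card_union_le _ _)
  rw [hammingDist]
  omega

variable [Fintype A] [Fintype B]

/-- Exchanging `y i` with `b` is an involution on pairs `(y, b)`. -/
lemma sum_sum_update (g : (Fin n → B) → ℝ) (i : Fin n) :
    ∑ y, ∑ b, g (Function.update y i b) = Fintype.card B * ∑ y, g y := by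
  let e : (Fin n → B) × B ≃ (Fin n → B) × B :=
    { toFun := fun p => (Function.update p.1 i p.2, p.1 i)
      invFun := fun p => (Function.update p.1 i p.2, p.1 i)
      left_inv := fun p => by simp
      right_inv := fun p => by simp }
  rw [← Fintype.sum_prod_type' fun (y : Fin n → B) b => g (Function.update y i b)]
  rw [show ∑ p : (Fin n → B) × B, g (Function.update p.1 i p.2) = ∑ p : (Fin n → B) × B, g p.1 from
    e.sum_comp fun p => g p.1, Fintype.sum_prod_type]
  simp [Finset.mul_sum]

variable [DecidableEq B]

/-- For a smooth weight, few points have many coordinates exposed to a set of small weight. -/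
lemma sum_exposedCoords_gt_le (w : (Fin n → B) → ℝ) (hw : ∀ y, 0 ≤ w y) {q : ℝ} (hq : 0 < q)
    (hq1 : q ≤ 1) (hs : ∀ y y', hammingDist y y' = 1 → q * w y ≤ w y')
    (E : Set (Fin n → B)) {δ : ℝ} (hδ : 0 < δ) :
    open Classical in
    ∑ y with ⌊δ * n⌋₊ < (exposedCoords E y).card, w y
      ≤ Fintype.card B / (q * δ) * ∑ y with y ∈ E, w y := by
  classical
  have hupd : ∀ y i b, q * w y ≤ w (Function.update y i b) := by
    intro y i b
    by_cases hb : b = y i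
    · subst hb
      rw [Function.update_eq_self]
      nlinarith [hw y]
    · refine hs _ _ ?_
      rw [hammingDist, Finset.card_eq_one]
      refine ⟨i, ?_⟩
      ext j
      by_cases hj : j = i
      · subst hj
        simpa using fun h => hb h.symm
      · simp [hj]
  have hmass : q * ∑ y, w y * (exposedCoords E y).card
      ≤ n * (Fintype.card B * ∑ y with y ∈ E, w y) := by
    calc q * ∑ y, w y * (exposedCoords E y).card
        = ∑ y, ∑ i, (if ∃ b, Function.update y i b ∈ E then q * w y else 0) := by
          rw [Finset.mul_sum]
          refine Finset.sum_congr rfl fun y _ => ?_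
          rw [← Finset.sum_filter, Finset.sum_const, nsmul_eq_mul]
          have : (exposedCoords E y).card
              = (Finset.univ.filter fun i => ∃ b, Function.update y i b ∈ E).card := by
            unfold exposedCoords
            congr
          rw [this]
          ring
      -- An exposed coordinate has a witness `b`, and smoothness bounds `q * w y` by the weight of
      -- the updated word.
      _ ≤ ∑ y, ∑ i, ∑ b, (if Function.update y i b ∈ E then w (Function.update y i b) else 0) := by
          refine Finset.sum_le_sum fun y _ => Finset.sum_le_sum fun i _ => ?_
          have h0 : ∀ b ∈ Finset.univ, 0 ≤
              if Function.update y i b ∈ E then w (Function.update y i b) else 0 := by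
            intro b _
            split_ifs
            exacts [hw _, le_rfl]
          split_ifs with h
          · obtain ⟨b, hb⟩ := h
            refine le_trans ?_ (Finset.single_le_sum h0 (Finset.mem_univ b))
            rw [if_pos hb]
            exact hupd y i b
          · exact Finset.sum_nonneg h0
      _ = n * (Fintype.card B * ∑ y with y ∈ E, w y) := by
          rw [Finset.sum_comm]
          simp_rw [sum_sum_update fun y => if y ∈ E then w y else 0]
          simp [Finset.sum_filter]
  -- Markov's inequality for the number of exposed coordinates.
  have hmarkov : (δ * n) * ∑ y with ⌊δ * n⌋₊ < (exposedCoords E y).card, w y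
      ≤ ∑ y, w y * (exposedCoords E y).card := by
    rw [Finset.mul_sum]
    refine le_trans (Finset.sum_le_sum fun y hy => ?_)
      (Finset.sum_le_sum_of_subset_of_nonneg (Finset.filter_subset _ _)
        fun y _ _ => mul_nonneg (hw y) (Nat.cast_nonneg _))
    rw [mul_comm]
    exact mul_le_mul_of_nonneg_left (Nat.lt_of_floor_lt (Finset.mem_filter.1 hy).2).le (hw y)
  have hE0 : 0 ≤ ∑ y with y ∈ E, w y := Finset.sum_nonneg fun y _ => hw y
  rcases Nat.eq_zero_or_pos n with rfl | hn
  · have : ∀ y : Fin 0 → B, ¬ ⌊δ * (0 : ℕ)⌋₊ < (exposedCoords E y).card := fun y => by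
      simp [exposedCoords]
    simp only [this, Finset.filter_false, Finset.sum_empty]
    positivity
  · have hn' : (0 : ℝ) < n := by exact_mod_cast hn
    rw [div_mul_eq_mul_div, le_div_iff₀ (by positivity)]
    refine le_of_mul_le_mul_left ?_ hn'
    calc (n : ℝ) * ((∑ y with ⌊δ * n⌋₊ < (exposedCoords E y).card, w y) * (q * δ))
        = q * ((δ * n) * ∑ y with ⌊δ * n⌋₊ < (exposedCoords E y).card, w y) := by ring
      _ ≤ q * ∑ y, w y * (exposedCoords E y).card := mul_le_mul_of_nonneg_left hmarkov hq.le
      _ ≤ _ := hmass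

/-- Version of `sum_exposedCoords_gt_le` with a parameter in `A`. -/
lemma sum_prod_exposedCoords_gt_le (w : A → (Fin n → B) → ℝ) (hw : ∀ a y, 0 ≤ w a y) {q : ℝ}
    (hq : 0 < q) (hq1 : q ≤ 1) (hs : ∀ a y y', hammingDist y y' = 1 → q * w a y ≤ w a y')
    (E : A → Set (Fin n → B)) {δ : ℝ} (hδ : 0 < δ) :
    open Classical in
    ∑ a, ∑ y with ⌊δ * n⌋₊ < (exposedCoords (E a) y).card, w a y
      ≤ Fintype.card B / (q * δ) * ∑ a, ∑ y with y ∈ E a, w a y := by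
  rw [Finset.mul_sum]
  exact Finset.sum_le_sum fun a _ =>
    sum_exposedCoords_gt_le (w a) (hw a) hq hq1 (hs a) (E a) hδ

end Smoothness

/-! ### Prefix codes -/

section Codes

variable {A B Z : Type*}

/-- Appending strings of a fixed length preserves the prefix condition. -/
lemma append_prefixFree {enc : A → List Bool}
    (hp : ∀ c ∈ Set.range enc, ∀ c' ∈ Set.range enc, c <+: c' → c = c')
    {l : ℕ} (s : A → List Bool) (hs : ∀ a, (s a).length = l) :
    ∀ c ∈ Set.range fun a => enc a ++ s a, ∀ c' ∈ Set.range fun a => enc a ++ s a,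
      c <+: c' → c = c' := by
  rintro _ ⟨a, rfl⟩ _ ⟨b, rfl⟩ h
  have h1 : enc a <+: enc b ++ s b := (List.prefix_append _ _).trans h
  have h2 : enc b <+: enc b ++ s b := List.prefix_append _ _
  have he : enc a = enc b := by
    rcases List.prefix_or_prefix_of_prefix h1 h2 with h | h
    · exact hp _ ⟨a, rfl⟩ _ ⟨b, rfl⟩ h
    · exact (hp _ ⟨b, rfl⟩ _ ⟨a, rfl⟩ h).symm
  refine h.eq_of_length ?_
  simp [he, hs]

/-- A pair of prefix encoders which is injective on a set `G` is part of a code recovering both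
inputs whenever they belong to `G`. -/
lemma exists_code_of_injOn (enc₁ : A → List Bool) (enc₂ : B → List Bool)
    (hp₁ : ∀ c ∈ Set.range enc₁, ∀ c' ∈ Set.range enc₁, c <+: c' → c = c')
    (hp₂ : ∀ c ∈ Set.range enc₂, ∀ c' ∈ Set.range enc₂, c <+: c' → c = c')
    (G : Set (A × B)) (hG : Set.InjOn (fun p => (enc₁ p.1, enc₂ p.2)) G) :
    ∃ Φ : Code A B (A × B), Φ.enc₁ = enc₁ ∧ Φ.enc₂ = enc₂ ∧
      ∀ p ∈ G, Φ.output p.1 p.2 = p := by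
  classical
  -- Decode to a point of `G` with these codewords if there is one; otherwise to arbitrary
  -- preimages.
  refine ⟨⟨enc₁, enc₂, fun c =>
    if h : ∃ p ∈ G, (enc₁ p.1, enc₂ p.2) = ((c.1 : List Bool), (c.2 : List Bool)) then h.choose
    else (c.1.2.choose, c.2.2.choose), hp₁, hp₂⟩, rfl, rfl, fun p hp => ?_⟩
  have h : ∃ p' ∈ G, (enc₁ p'.1, enc₂ p'.2) = (enc₁ p.1, enc₂ p.2) := ⟨p, hp, rfl⟩
  simp only [Code.output]
  rw [dif_pos h]
  exact hG h.choose_spec.1 hp h.choose_spec.2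

lemma avgLength_append [Fintype A] (p : PMF A) (φ φ' : A → List Bool) (l : ℕ)
    (h : ∀ a, (φ' a).length = (φ a).length + l) :
    avgLength p φ' = avgLength p φ + l := by
  have hsum : ∑ a, (p a).toReal = 1 := by
    rw [← ENNReal.toReal_sum fun a _ => p.apply_ne_top a, ← tsum_fintype (L := .unconditional _),
      p.tsum_coe, ENNReal.toReal_one]
  simp only [avgLength, h, Nat.cast_add, mul_add, Finset.sum_add_distrib, ← Finset.sum_mul, hsum,
    one_mul]

lemma Code.errorProb_nonneg [Fintype A] [Fintype B] (Φ : Code A B Z) (p : PMF (A × B))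
    (f : A → B → Z) : 0 ≤ Φ.errorProb p f :=
  Finset.sum_nonneg fun _ _ => ENNReal.toReal_nonneg

end Codes

/-! ### From computing `f` to recovering both inputs -/

section Reduction

variable {X Y Z : Type*} [Fintype X] [DecidableEq X] [Fintype Y] [DecidableEq Y] {n : ℕ}

/-- A code for a totally sensitive function becomes a code for the identity function after
appending, to both codewords, a colour that separates nearby inputs. -/
lemma exists_identity_code {f : (Fin n → X) → (Fin n → Y) → Z} (hf : TotallySensitive f)
    (p : PMF ((Fin n → X) × (Fin n → Y))) {q₁ q₂ : ℝ} (hq₁ : 0 < q₁) (hq₁' : q₁ ≤ 1)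
    (hq₂ : 0 < q₂) (hq₂' : q₂ ≤ 1)
    (hs₁ : ∀ x x' y, hammingDist x x' = 1 → q₁ * (p (x, y)).toReal ≤ (p (x', y)).toReal)
    (hs₂ : ∀ x y y', hammingDist y y' = 1 → q₂ * (p (x, y)).toReal ≤ (p (x, y')).toReal)
    (Φ : Code (Fin n → X) (Fin n → Y) Z) {δ : ℝ} (hδ : 0 < δ) (l₁ l₂ : ℕ)
    (hl₁ : ∀ x : Fin n → X,
      (Finset.univ.filter fun x' => hammingDist x x' ≤ 2 * ⌊δ * n⌋₊).card ≤ 2 ^ l₁)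
    (hl₂ : ∀ y : Fin n → Y,
      (Finset.univ.filter fun y' => hammingDist y y' ≤ 2 * ⌊δ * n⌋₊).card ≤ 2 ^ l₂) :
    ∃ Ψ : Code (Fin n → X) (Fin n → Y) ((Fin n → X) × (Fin n → Y)),
      (∀ x, (Ψ.enc₁ x).length = (Φ.enc₁ x).length + l₁) ∧
      (∀ y, (Ψ.enc₂ y).length = (Φ.enc₂ y).length + l₂) ∧
      Ψ.errorProb p (idFun X Y n) ≤ Φ.errorProb p f
        + (Fintype.card X / q₁ + Fintype.card Y / q₂) * (Φ.errorProb p f / δ) := by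
  classical
  obtain ⟨hJ, hF, hS⟩ := hf
  set k := ⌊δ * n⌋₊ with hk
  obtain ⟨c₁, hc₁⟩ := exists_hamming_coloring (C := Fin l₁ → Bool) (2 * k) (by simpa using hl₁)
  obtain ⟨c₂, hc₂⟩ := exists_hamming_coloring (C := Fin l₂ → Bool) (2 * k) (by simpa using hl₂)
  set Bad : Set ((Fin n → X) × (Fin n → Y)) := {a | f a.1 a.2 ≠ Φ.output a.1 a.2} with hBad
  set E₂ : (Fin n → X) → Set (Fin n → Y) := fun x => {y | (x, y) ∈ Bad} with hE₂
  set E₁ : (Fin n → Y) → Set (Fin n → X) := fun y => {x | (x, y) ∈ Bad} with hE₁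
  set G : Set ((Fin n → X) × (Fin n → Y)) := {a | a ∉ Bad ∧
    (exposedCoords (E₂ a.1) a.2).card ≤ k ∧ (exposedCoords (E₁ a.2) a.1).card ≤ k} with hG
  have hout : ∀ x x' y y', Φ.enc₁ x = Φ.enc₁ x' → Φ.enc₂ y = Φ.enc₂ y' →
      Φ.output x y = Φ.output x' y' := by
    intro x x' y y' h1 h2
    simp only [Code.output]
    congr 1
    exact Prod.ext (Subtype.ext h1) (Subtype.ext h2)
  have hinj : Set.InjOn (fun a : (Fin n → X) × (Fin n → Y) =>
      (Φ.enc₁ a.1 ++ List.ofFn (c₁ a.1), Φ.enc₂ a.2 ++ List.ofFn (c₂ a.2))) G := by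
    rintro ⟨x, y⟩ ⟨hb, hy, hx⟩ ⟨x', y'⟩ ⟨hb', hy', hx'⟩ heq
    obtain ⟨h1, h2⟩ := Prod.mk.inj heq
    obtain ⟨he₁, hcol₁⟩ := List.append_inj' h1 (by simp)
    obtain ⟨he₂, hcol₂⟩ := List.append_inj' h2 (by simp)
    replace hcol₁ := List.ofFn_injective hcol₁
    replace hcol₂ := List.ofFn_injective hcol₂
    simp only [hBad, Set.mem_ofPred_eq, not_not] at hb hb'
    have hval : f x y = f x' y' := by rw [hb, hb', hout x x' y y' he₁ he₂]
    by_cases hxx : x = x'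
    · subst hxx
      by_cases hyy : y = y'
      · rw [hyy]
      -- Equal colours would be excluded by proximity: each `i` where `y`, `y'` differ is exposed at
      -- `x`, for `y` or for `y'`.
      · refine absurd hcol₂ (hc₂ y y' hyy (hammingDist_le_of_exposed hx hx' fun i hi => ?_))
        obtain ⟨z, -, hz, hne⟩ := hF x y y' i hval hi
        refine ⟨z i, ?_⟩
        rw [Function.update_eq_iff.2 ⟨rfl, fun j hj => (hz j hj).symm⟩]
        -- Were both modified pairs decoded correctly, equal codewords would force equal values of
        -- `f`.
        by_contra! hcon
        simp only [hE₁, hBad, Set.mem_ofPred_eq, not_not] at hcon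
        exact hne (by rw [hcon.1, hcon.2, hout z z y y' rfl he₂])
    · by_cases hyy : y = y'
      · subst hyy
        refine absurd hcol₁ (hc₁ x x' hxx (hammingDist_le_of_exposed hy hy' fun i hi => ?_))
        obtain ⟨z, -, hz, hne⟩ := hS x x' y i hval hi
        refine ⟨z i, ?_⟩
        rw [Function.update_eq_iff.2 ⟨rfl, fun j hj => (hz j hj).symm⟩]
        by_contra! hcon
        simp only [hE₂, hBad, Set.mem_ofPred_eq, not_not] at hcon
        exact hne (by rw [hcon.1, hcon.2, hout x x' z z he₁ rfl])
      · exact absurd hval (hJ x x' y y' hxx hyy)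
  obtain ⟨Ψ, hΨ₁, hΨ₂, hΨ⟩ := exists_code_of_injOn (fun x => Φ.enc₁ x ++ List.ofFn (c₁ x))
    (fun y => Φ.enc₂ y ++ List.ofFn (c₂ y))
    (append_prefixFree Φ.prefix₁ _ (l := l₁) fun x => by simp)
    (append_prefixFree Φ.prefix₂ _ (l := l₂) fun y => by simp) G hinj
  refine ⟨Ψ, fun x => by simp [hΨ₁], fun y => by simp [hΨ₂], ?_⟩
  have hε : Φ.errorProb p f = ∑ a with a ∈ Bad, (p a).toReal := by
    simp only [Code.errorProb, hBad, Set.mem_ofPred_eq]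
  have hp0 : ∀ a, 0 ≤ (p a).toReal := fun a => ENNReal.toReal_nonneg
  have hε₂ : ∑ x, ∑ y with y ∈ E₂ x, (p (x, y)).toReal = Φ.errorProb p f := by
    rw [hε, Finset.sum_filter, Fintype.sum_prod_type]
    simp only [Finset.sum_filter, hE₂, Set.mem_ofPred_eq]
  have hε₁ : ∑ y, ∑ x with x ∈ E₁ y, (p (x, y)).toReal = Φ.errorProb p f := by
    rw [hε, Finset.sum_filter, Fintype.sum_prod_type_right]
    simp only [Finset.sum_filter, hE₁, Set.mem_ofPred_eq]
  have hb₂ : ∑ x, ∑ y with k < (exposedCoords (E₂ x) y).card, (p (x, y)).toReal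
      ≤ Fintype.card Y / (q₂ * δ) * Φ.errorProb p f := by
    rw [← hε₂]
    convert sum_prod_exposedCoords_gt_le (fun x y => (p (x, y)).toReal) (fun _ _ => hp0 _)
      hq₂ hq₂' hs₂ E₂ hδ
  have hb₁ : ∑ y, ∑ x with k < (exposedCoords (E₁ y) x).card, (p (x, y)).toReal
      ≤ Fintype.card X / (q₁ * δ) * Φ.errorProb p f := by
    rw [← hε₁]
    convert sum_prod_exposedCoords_gt_le (fun y x => (p (x, y)).toReal) (fun _ _ => hp0 _)
      hq₁ hq₁' (fun y x x' => hs₁ x x' y) E₁ hδ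
  -- Union bound over the three ways of leaving `G`.
  have hmain : Ψ.errorProb p (idFun X Y n) ≤ Φ.errorProb p f
      + ∑ y, ∑ x with k < (exposedCoords (E₁ y) x).card, (p (x, y)).toReal
      + ∑ x, ∑ y with k < (exposedCoords (E₂ x) y).card, (p (x, y)).toReal := by
    rw [hε]
    simp only [Code.errorProb, Finset.sum_filter]
    rw [← Fintype.sum_prod_type_right' fun x y =>
        if k < (exposedCoords (E₁ y) x).card then (p (x, y)).toReal else 0,
      ← Fintype.sum_prod_type' fun x y =>
        if k < (exposedCoords (E₂ x) y).card then (p (x, y)).toReal else 0,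
      ← Finset.sum_add_distrib, ← Finset.sum_add_distrib]
    refine Finset.sum_le_sum fun a _ => ?_
    have hcase : idFun X Y n a.1 a.2 ≠ Ψ.output a.1 a.2 → a ∈ Bad ∨
        k < (exposedCoords (E₁ a.2) a.1).card ∨ k < (exposedCoords (E₂ a.1) a.2).card := by
      intro h
      by_contra! hcon
      exact h (hΨ a ⟨hcon.1, hcon.2.2, hcon.2.1⟩).symm
    have h0 := hp0 a
    by_cases h : idFun X Y n a.1 a.2 ≠ Ψ.output a.1 a.2
    · rw [if_pos h]
      rcases hcase h with h' | h' | h' <;> rw [if_pos h'] <;> split_ifs <;> linarith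
    · rw [if_neg h]
      split_ifs <;> linarith
  have e : (Fintype.card X / q₁ + Fintype.card Y / q₂) * (Φ.errorProb p f / δ)
      = Fintype.card X / (q₁ * δ) * Φ.errorProb p f
        + Fintype.card Y / (q₂ * δ) * Φ.errorProb p f := by
    field_simp
  rw [e]
  linarith

end Reduction

/-! ### Asymptotics and rate regions -/

section Regions

variable {X Y : Type*} [Fintype X] [Fintype Y] {Z : ℕ → Type*}

lemma limsup_div_add_le {u : ℕ → ℝ} {l : ℕ → ℕ} {R : ℝ}
    (hu : limsup (fun n : ℕ => ((u n / n : ℝ) : EReal)) atTop ≤ (R : EReal))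
    (hl : Tendsto (fun n => (l n : ℝ) / n) atTop (𝓝 0)) :
    limsup (fun n : ℕ => (((u n + l n) / n : ℝ) : EReal)) atTop ≤ (R : EReal) := by
  -- A finite upper limit here rules out the indeterminate sums in `EReal` subadditivity.
  have hl' : limsup (fun n : ℕ => ((l n / n : ℝ) : EReal)) atTop = 0 := by
    have := (continuous_coe_real_ereal.tendsto 0).comp hl
    exact this.limsup_eq
  have hadd := EReal.limsup_add_le (f := atTop) (u := fun n : ℕ => ((u n / n : ℝ) : EReal))
    (v := fun n : ℕ => ((l n / n : ℝ) : EReal)) (by simp [hl']) (by simp [hl'])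
  rw [hl', add_zero] at hadd
  refine le_trans (le_of_eq ?_) (hadd.trans hu)
  congr 1
  ext n
  simp [add_div]

/-- Composing the decoder with `f` turns a code for the identity function into a code for `f`. -/
lemma exists_function_code {W : Type*} {n : ℕ}
    (Φ : Code (Fin n → X) (Fin n → Y) ((Fin n → X) × (Fin n → Y)))
    (f : (Fin n → X) → (Fin n → Y) → W) :
    ∃ Ψ : Code (Fin n → X) (Fin n → Y) W, Ψ.enc₁ = Φ.enc₁ ∧ Ψ.enc₂ = Φ.enc₂ ∧
      ∀ p, Ψ.errorProb p f ≤ Φ.errorProb p (idFun X Y n) := by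
  refine ⟨⟨Φ.enc₁, Φ.enc₂, fun c => f (Φ.dec c).1 (Φ.dec c).2, Φ.prefix₁, Φ.prefix₂⟩, rfl, rfl,
    fun p => ?_⟩
  refine Finset.sum_le_sum_of_subset_of_nonneg (fun a ha => ?_) fun _ _ _ => ENNReal.toReal_nonneg
  simp only [Finset.mem_filter, Finset.mem_univ, true_and] at ha ⊢
  intro h
  refine ha ?_
  simp only [Code.output, idFun] at h ⊢
  rw [← h]

lemma attains_of_attains_idFun {P : GeneralSource X Y}
    (f : ∀ n, (Fin n → X) → (Fin n → Y) → Z n) {R : ℝ × ℝ}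
    {Φ : ∀ n, Code (Fin n → X) (Fin n → Y) ((Fin n → X) × (Fin n → Y))}
    (h : Attains P (idFun X Y) Φ R) :
    ∃ Ψ : ∀ n, Code (Fin n → X) (Fin n → Y) (Z n), Attains P f Ψ R ∧
      ((∀ n, (Φ n).IsFixedLength) → ∀ n, (Ψ n).IsFixedLength) := by
  choose Ψ h₁ h₂ hΨ using fun n => exists_function_code (Φ n) (f n)
  obtain ⟨he, hr₁, hr₂⟩ := h
  refine ⟨Ψ, ⟨squeeze_zero (fun n => Code.errorProb_nonneg _ _ _) (fun n => hΨ n (P n)) he,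
    by simpa only [h₁] using hr₁, by simpa only [h₂] using hr₂⟩, fun hfl n => ?_⟩
  simpa only [Code.IsFixedLength, h₁, h₂] using hfl n

/-- Covers block length 0, where sensitivity is not assumed but a code must still be supplied. -/
lemma totallySensitive_zero {X Y W : Type*} (f : (Fin 0 → X) → (Fin 0 → Y) → W) :
    TotallySensitive f :=
  ⟨fun x x' _ _ h => absurd (Subsingleton.elim x x') h, fun _ _ _ i => i.elim0,
    fun _ _ _ i => i.elim0⟩

variable [DecidableEq X] [DecidableEq Y]

lemma attains_idFun_of_attains {P : GeneralSource X Y} (hP : Smooth P)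
    {f : ∀ n, (Fin n → X) → (Fin n → Y) → Z n} (hf : ∀ n, 1 ≤ n → TotallySensitive (f n))
    {R : ℝ × ℝ} {Φ : ∀ n, Code (Fin n → X) (Fin n → Y) (Z n)} (h : Attains P f Φ R) :
    ∃ Ψ : ∀ n, Code (Fin n → X) (Fin n → Y) ((Fin n → X) × (Fin n → Y)),
      Attains P (idFun X Y) Ψ R ∧
      ((∀ n, (Φ n).IsFixedLength) → ∀ n, (Ψ n).IsFixedLength) := by
  obtain ⟨⟨q₁, hq₁, hq₁', hs₁⟩, ⟨q₂, hq₂, hq₂', hs₂⟩⟩ := hP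
  obtain ⟨he, hr₁, hr₂⟩ := h
  have hf' : ∀ n, TotallySensitive (f n) := by
    rintro (_ | n)
    exacts [totallySensitive_zero _, hf _ (by omega)]
  have hs₁' : ∀ n (x x' : Fin n → X) (y : Fin n → Y), hammingDist x x' = 1 →
      q₁ * (P n (x, y)).toReal ≤ (P n (x', y)).toReal := by
    rintro (_ | n) x x' y hd
    · simp [Subsingleton.elim x x'] at hd
    · exact hs₁ _ (by omega) x x' y hd
  have hs₂' : ∀ n (x : Fin n → X) (y y' : Fin n → Y), hammingDist y y' = 1 →
      q₂ * (P n (x, y)).toReal ≤ (P n (x, y')).toReal := by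
    rintro (_ | n) x y y' hd
    · simp [Subsingleton.elim y y'] at hd
    · exact hs₂ _ (by omega) x y y' hd
  set ε : ℕ → ℝ := fun n => (Φ n).errorProb (P n) (f n) with hε
  have hε0 : ∀ n, 0 ≤ ε n := fun n => Code.errorProb_nonneg _ _ _
  -- The square root gives `ε n / δ n ≤ √(ε n)`; the second term keeps `δ n` positive when `ε n =
  -- 0`.
  set δ : ℕ → ℝ := fun n => √(ε n) + 1 / ((n : ℝ) + 1) with hδdef
  have hδ : ∀ n, 0 < δ n := fun n => by positivity
  have hsqrt : Tendsto (fun n => √(ε n)) atTop (𝓝 0) := by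
    simpa [Function.comp_def] using (Real.continuous_sqrt.tendsto 0).comp he
  have hδ0 : Tendsto δ atTop (𝓝 0) := by
    simpa [hδdef] using hsqrt.add tendsto_one_div_add_atTop_nhds_zero_nat
  obtain ⟨l₁, hl₁0, hl₁⟩ := exists_sublinear_log_card_hammingBall X hδ hδ0
  obtain ⟨l₂, hl₂0, hl₂⟩ := exists_sublinear_log_card_hammingBall Y hδ hδ0
  choose Ψ hΨ₁ hΨ₂ hΨ using fun n => exists_identity_code (hf' n) (P n) hq₁ hq₁'.le hq₂ hq₂'.le
    (hs₁' n) (hs₂' n) (Φ n) (hδ n) (l₁ n) (l₂ n) (hl₁ n) (hl₂ n)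
  have hratio : Tendsto (fun n => ε n / δ n) atTop (𝓝 0) := by
    refine squeeze_zero (fun n => div_nonneg (hε0 n) (hδ n).le) (fun n => ?_) hsqrt
    rw [div_le_iff₀ (hδ n)]
    have h1 : (0 : ℝ) ≤ 1 / ((n : ℝ) + 1) := by positivity
    simp only [hδdef]
    nlinarith [Real.mul_self_sqrt (hε0 n), mul_nonneg (Real.sqrt_nonneg (ε n)) h1]
  refine ⟨Ψ, ⟨?_, ?_, ?_⟩, fun hfl n => ⟨fun a a' => ?_, fun b b' => ?_⟩⟩
  · refine squeeze_zero (fun n => Code.errorProb_nonneg _ _ _) hΨ ?_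
    simpa using he.add (hratio.const_mul (Fintype.card X / q₁ + Fintype.card Y / q₂))
  · simp_rw [avgLength_append _ _ _ _ (hΨ₁ _)]
    exact limsup_div_add_le hr₁ hl₁0
  · simp_rw [avgLength_append _ _ _ _ (hΨ₂ _)]
    exact limsup_div_add_le hr₂ hl₂0
  · rw [hΨ₁, hΨ₁, (hfl n).1 a a']
  · rw [hΨ₂, hΨ₂, (hfl n).2 b b']

end Regions

end FunctionComputation

theorem mainTheorem1 {X Y : Type*} [Fintype X] [DecidableEq X] [Fintype Y] [DecidableEq Y]
    {Z : ℕ → Type*} (P : FunctionComputation.GeneralSource X Y)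
    (hP : FunctionComputation.Smooth P)
    (f : ∀ n, (Fin n → X) → (Fin n → Y) → Z n)
    (hf : ∀ n, 1 ≤ n → FunctionComputation.TotallySensitive (f n)) :
    FunctionComputation.regionFL P f = FunctionComputation.regionSWFL P ∧
      FunctionComputation.regionVL P f = FunctionComputation.regionSWVL P := by
  refine ⟨Set.Subset.antisymm ?_ ?_, Set.Subset.antisymm ?_ ?_⟩
  · rintro R ⟨Φ, hfl, hΦ⟩
    obtain ⟨Ψ, hΨ, hΨfl⟩ := FunctionComputation.attains_idFun_of_attains hP hf hΦ
    exact ⟨Ψ, hΨfl hfl, hΨ⟩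
  · rintro R ⟨Φ, hfl, hΦ⟩
    obtain ⟨Ψ, hΨ, hΨfl⟩ := FunctionComputation.attains_of_attains_idFun f hΦ
    exact ⟨Ψ, hΨfl hfl, hΨ⟩
  · rintro R ⟨Φ, hΦ⟩
    obtain ⟨Ψ, hΨ, -⟩ := FunctionComputation.attains_idFun_of_attains hP hf hΦ
    exact ⟨Ψ, hΨ⟩
  · rintro R ⟨Φ, hΦ⟩
    obtain ⟨Ψ, hΨ, -⟩ := FunctionComputation.attains_of_attains_idFun f hΦ
    exact ⟨Ψ, hΨ⟩
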